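/- Let $m,n\ge 1$ be integers with $m+n\ge 3$, and let $\Theta\in\mathbb{R}^{n\times m}$. Let $\sigma=(\sigma_1,\dots,\sigma_m)$ and $\rho=(\rho_1,\dots,\rho_n)$ be weights, that is, vectors of positive reals with $\sigma_1\ge\dots\ge\sigma_m$, $\rho_1\ge\dots\ge\rho_n$ and $\sum_{j}\sigma_j=\sum_i\rho_i=1$. Put $|x|_\sigma=\max_{j}|x_j|^{1/\sigma_j}$ for $x\in\mathbb{R}^m$ and $|y|_\rho=\max_i|y_i|^{1/\rho_i}$ for $y\in\mathbb{R}^n$. The uniform weighted Diophantine exponent $\hat\omega_{\sigma,\rho}(\Theta)\in[-\infty,+\infty]$ is the supremum of the real numbers $\gamma$ such that, for every sufficiently large real $t$, the system $$|x|_\sigma\le t,\qquad |\Theta x-y|_\rho\le t^{-\gamma}$$ has a nonzero solution $(x,y)\in\mathbb{Z}^{m}\times\mathbb{Z}^n$; the exponent $\hat\omega_{\rho,\sigma}({}^t\Theta)$ is defined in the same way from the transposed matrix ${}^t\Theta\in\mathbb{R}^{m\times n}$, with the roles of $(m,\sigma)$ and $(n,\rho)$ exchanged. Set $\hat\omega=\hat\omega_{\sigma,\rho}(\Theta)$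 and ${}^t\hat\omega=\hat\omega_{\rho,\sigma}({}^t\Theta)$, and suppose that $\hat\omega<(1-\rho_n)^{-1}$. Then $${}^t\hat\omega\le\begin{cases}\dfrac{\rho_n}{1-(1-\rho_n)\hat\omega}&\text{if }\hat\omega\ge\dfrac{1-\sigma_m}{1-\rho_n},\\[3mm]\dfrac{1-(1-\sigma_m)\hat\omega^{-1}}{\sigma_m}&\text{if }\hat\omega\le\dfrac{1-\sigma_m}{1-\rho_n}.\end{cases}$$ If $n=1$ (so that $\rho_n=1$), both $(1-\rho_n)^{-1}$ and $\frac{1-\sigma_m}{1-\rho_n}$ are read as $+\infty$. -/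

import Mathlib

noncomputable section

/-- The weighted norm `|x|_w = max_j |x_j|^{1/w_j}` on `ℝ^k` (a maximum over a finite index set). -/
def weightedNorm {k : ℕ} (w : Fin k → ℝ) (x : Fin k → ℝ) : ℝ :=
  ⨆ j : Fin k, |x j| ^ (1 / w j)

/-- The system `|x|_σ ≤ t`, `|Θ x - y|_ρ ≤ t^{-γ}` has a nonzero solution `(x, y)` in
integer vectors. -/
def HasNonzeroSolution {m n : ℕ} (σ : Fin m → ℝ) (ρ : Fin n → ℝ)
    (Θ : Matrix (Fin n) (Fin m) ℝ) (γ t : ℝ) : Prop :=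
  ∃ (x : Fin m → ℤ) (y : Fin n → ℤ), (x, y) ≠ (0, 0) ∧
    weightedNorm σ (fun j => (x j : ℝ)) ≤ t ∧
    weightedNorm ρ (fun i => Θ.mulVec (fun j => (x j : ℝ)) i - (y i : ℝ)) ≤ t ^ (-γ)

/-- The uniform weighted Diophantine exponent: the supremum, in `[-∞, +∞]`, of the real `γ` such
that the system has a nonzero integer solution for every `t` large enough. -/
def uniformExponent {m n : ℕ} (σ : Fin m → ℝ) (ρ : Fin n → ℝ)
    (Θ : Matrix (Fin n) (Fin m) ℝ) : EReal :=
  sSup ((fun γ : ℝ => (γ : EReal)) '' {γ : ℝ | ∃ T : ℝ, ∀ t : ℝ, T ≤ t → HasNonzeroSolution σ ρ Θ γ t})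

/-- The quotient `a / b` of real numbers, with the convention `a / 0 = +∞`
(it is used only for `a, b ≥ 0` that are not both zero). -/
def extQuotient (a b : ℝ) : EReal :=
  if b = 0 then ⊤ else ((a / b : ℝ) : EReal)

/-- `w = (w_1, …, w_k)` is a weight vector: positive, non-increasing, with sum `1`. -/
structure IsWeight {k : ℕ} (w : Fin k → ℝ) : Prop where
  pos : ∀ j, 0 < w j
  antitone : Antitone w
  sum_eq_one : ∑ j, w j = 1

end

/-! Transference by contradiction. Suppose the transposed system with some exponent `α` above the
claimed bound is solvable for all large `t`; then the original system is solvable for all large `s`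
with some `β > ω̂`, which is absurd.

Fix `s`. The suitably scaled forms `x`, `Θ x - y` span a lattice of covolume about `s ^ (β - 1)`,
whose dual is given by the forms `b - ᵗΘ a` and `a`. Solving the transposed system at `t = s ^ τ`
for every `1 / α ≤ τ ≤ β` puts nonzero dual points into a whole family of boxes (`exists_exponent`).
Such a family forces either one very short dual vector or two independent ones with small 2×2 minors
(`exists_short_of_dual_boxes`). Minkowski's theorem, with one or two coordinates replaced by these
integer-valued forms, then gives a short vector of the lattice itself.

At `β = ω̂` the argument needs two strict inequalities, each a lower bound on `α`. The two cases of
the theorem record which bound is larger. -/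

/-! ### Short lattice vectors from the dual lattice -/

open MeasureTheory in
/-- Minkowski's theorem on linear forms. -/
lemma exists_int_abs_mulVec_lt_one {ι : Type*} [Fintype ι] [DecidableEq ι]
    (N : Matrix ι ι ℝ) (h0 : N.det ≠ 0) (h1 : |N.det| < 1) :
    ∃ z : ι → ℤ, z ≠ 0 ∧ ∀ k, |N.mulVec (fun i => (z i : ℝ)) k| < 1 := by
  let b := Pi.basisFun ℝ ι
  let L : AddSubgroup (ι → ℝ) := (Submodule.span ℤ (Set.range b)).toAddSubgroup
  have hcount : Countable L :=
    inferInstanceAs (Countable (Submodule.span ℤ (Set.range b)))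
  have hfund : IsAddFundamentalDomain L (ZSpan.fundamentalDomain b) volume :=
    ZSpan.isAddFundamentalDomain b volume
  have hvolF : volume (ZSpan.fundamentalDomain b) = 1 := by
    rw [ZSpan.fundamentalDomain_pi_basisFun, volume_pi_pi]
    simp
  let B : Set (ι → ℝ) := Set.univ.pi fun _ => Set.Ioo (-1 : ℝ) 1
  let K : Set (ι → ℝ) := Matrix.toLin' N ⁻¹' B
  have hBconv : Convex ℝ B := convex_pi fun _ _ => convex_Ioo _ _
  have hKconv : Convex ℝ K := hBconv.linear_preimage _
  have hKsymm : ∀ x ∈ K, -x ∈ K := by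
    intro x hx k hk
    have h := hx k hk
    simp only [map_neg, Pi.neg_apply, Set.mem_Ioo] at h ⊢
    constructor <;> linarith [h.1, h.2]
  have hvolK : volume K = ENNReal.ofReal |N.det⁻¹| * 2 ^ Fintype.card ι := by
    have hdet : LinearMap.det (Matrix.toLin' N) ≠ 0 := by rwa [LinearMap.det_toLin']
    rw [Measure.addHaar_preimage_linearMap volume hdet, LinearMap.det_toLin', volume_pi_pi]
    congr 1
    norm_num
  have hlt : volume (ZSpan.fundamentalDomain b) * 2 ^ Module.finrank ℝ (ι → ℝ) < volume K := by
    rw [hvolF, hvolK, Module.finrank_fintype_fun_eq_card]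
    refine ENNReal.mul_lt_mul_left (by simp) (by simp) ?_
    rw [← ENNReal.ofReal_one, ENNReal.ofReal_lt_ofReal_iff (by positivity), abs_inv]
    exact (one_lt_inv₀ (abs_pos.2 h0)).2 h1
  obtain ⟨x, hx0, hxK⟩ :=
    exists_ne_zero_mem_lattice_of_measure_mul_two_pow_lt_measure hfund hKsymm hKconv hlt
  have hxL : (x : ι → ℝ) ∈ Submodule.span ℤ (Set.range b) := x.2
  rw [b.mem_span_iff_repr_mem ℤ] at hxL
  choose z hz using hxL
  have hzx : (fun i => (z i : ℝ)) = (x : ι → ℝ) := by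
    funext i
    simpa [b] using hz i
  refine ⟨z, ?_, fun k => ?_⟩
  · rintro rfl
    exact hx0 (Subtype.ext (by rw [← hzx]; funext i; simp))
  · rw [hzx, abs_lt]
    simpa using hxK k (Set.mem_univ k)

lemma updateRow_one_mulVec {ι : Type*} [Fintype ι] [DecidableEq ι] (k₀ : ι) (w v : ι → ℝ) :
    ((1 : Matrix ι ι ℝ).updateRow k₀ w).mulVec v = Function.update v k₀ (w ⬝ᵥ v) := by
  rw [Matrix.updateRow_mulVec, Matrix.one_mulVec]

lemma det_updateRow_one {ι : Type*} [Fintype ι] [DecidableEq ι] (k₀ : ι) (w : ι → ℝ) :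
    ((1 : Matrix ι ι ℝ).updateRow k₀ w).det = w k₀ := by
  rw [← Matrix.cramer_transpose_apply]
  simp

/-- Solve the relation for coordinate `k₀`: each other term is at most `|w k₀| * r`. -/
lemma abs_coord_le_of_dotProduct_eq_zero {ι : Type*} [Fintype ι] {w v : ι → ℝ} {k₀ : ι} {r : ℝ}
    (hr : 0 ≤ r) (h0 : w ⬝ᵥ v = 0) (hk : w k₀ ≠ 0)
    (h : ∀ k, k ≠ k₀ → |w k * v k| ≤ |w k₀| * r) : |v k₀| ≤ Fintype.card ι * r := by
  classical
  have h1 : w k₀ * v k₀ = -∑ k ∈ Finset.univ.erase k₀, w k * v k := by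
    have := Finset.add_sum_erase Finset.univ (fun k => w k * v k) (Finset.mem_univ k₀)
    simp only [dotProduct] at h0
    linarith
  have h2 : |w k₀| * |v k₀| ≤ Fintype.card ι * (|w k₀| * r) := by
    rw [← abs_mul, h1, abs_neg]
    calc _ ≤ ∑ k ∈ Finset.univ.erase k₀, |w k * v k| := Finset.abs_sum_le_sum_abs _ _
      _ ≤ ∑ _k ∈ Finset.univ.erase k₀, |w k₀| * r :=
          Finset.sum_le_sum fun k hk => h k (Finset.ne_of_mem_erase hk)
      _ ≤ ∑ _k : ι, |w k₀| * r :=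
          Finset.sum_le_sum_of_subset_of_nonneg (Finset.erase_subset _ _)
            fun _ _ _ => by positivity
      _ = _ := by simp
  have h3 : 0 < |w k₀| := abs_pos.2 hk
  nlinarith

lemma eq_zero_of_abs_lt_one_of_int {r : ℝ} (h : |r| < 1) (hr : ∃ c : ℤ, r = c) : r = 0 := by
  obtain ⟨c, rfl⟩ := hr
  have : |c| < 1 := by exact_mod_cast h
  rw [Int.abs_lt_one_iff.1 this, Int.cast_zero]

lemma one_le_card_of_index {ι : Type*} [Fintype ι] (k : ι) : (1 : ℝ) ≤ Fintype.card ι := by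
  exact_mod_cast Fintype.card_pos_iff.2 ⟨k⟩

/-- A short vector of a lattice from one short vector of its dual. -/
lemma exists_short_of_dual {ι : Type*} [Fintype ι] [DecidableEq ι] (M : Matrix ι ι ℝ)
    (hM : M.det ≠ 0) (w : ι → ℝ) (hw : w ≠ 0)
    (hint : ∀ z : ι → ℤ, ∃ c : ℤ, w ⬝ᵥ M.mulVec (fun i => (z i : ℝ)) = c)
    (hsmall : ∀ k, |w k| * |M.det| < 1) :
    ∃ z : ι → ℤ, z ≠ 0 ∧
      ∀ k, |M.mulVec (fun i => (z i : ℝ)) k| ≤ (Fintype.card ι : ℝ) ^ 2 := by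
  obtain ⟨k', hk'⟩ := Function.ne_iff.1 hw
  obtain ⟨k₀, -, hk₀⟩ := Finset.exists_max_image Finset.univ (fun k => |w k|) ⟨k', Finset.mem_univ _⟩
  have hwk : w k₀ ≠ 0 := abs_pos.1 ((abs_pos.2 hk').trans_le (hk₀ k' (Finset.mem_univ _)))
  -- Coordinate `k₀` is replaced by the form `w`. Integer-valued on the lattice and below 1, the
  -- form vanishes; since `|w k₀|` is maximal, the other coordinates then control the missing one.
  obtain ⟨z, hz0, hz⟩ := exists_int_abs_mulVec_lt_one ((1 : Matrix ι ι ℝ).updateRow k₀ w * M)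
    (by rw [Matrix.det_mul, det_updateRow_one]; exact mul_ne_zero hwk hM)
    (by rw [Matrix.det_mul, det_updateRow_one, abs_mul]; exact hsmall k₀)
  refine ⟨z, hz0, ?_⟩
  have hint := hint z
  simp only [← Matrix.mulVec_mulVec, updateRow_one_mulVec] at hz
  generalize M.mulVec (fun i => (z i : ℝ)) = v at *
  have hother : ∀ k, k ≠ k₀ → |v k| ≤ 1 := fun k hk => by
    simpa [hk] using (hz k).le
  have hzero : w ⬝ᵥ v = 0 :=
    eq_zero_of_abs_lt_one_of_int (by simpa using hz k₀) hint
  have hcard := one_le_card_of_index k₀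
  intro k
  by_cases hk : k = k₀
  · subst hk
    refine (abs_coord_le_of_dotProduct_eq_zero zero_le_one hzero hwk fun i hi => ?_).trans
      (by nlinarith)
    rw [abs_mul]
    exact mul_le_mul (hk₀ i (Finset.mem_univ _)) (hother i hi) (abs_nonneg _) (abs_nonneg _)
  · exact (hother k hk).trans (by nlinarith)

/-- A short vector of a lattice from two independent short vectors of its dual. -/
lemma exists_short_of_dual_pair {ι : Type*} [Fintype ι] [DecidableEq ι] (M : Matrix ι ι ℝ)
    (hM : M.det ≠ 0) (w₁ w₂ : ι → ℝ) (hw₁ : w₁ ≠ 0) (hw₂ : ∀ c : ℝ, w₂ ≠ c • w₁)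
    (hint₁ : ∀ z : ι → ℤ, ∃ c : ℤ, w₁ ⬝ᵥ M.mulVec (fun i => (z i : ℝ)) = c)
    (hint₂ : ∀ z : ι → ℤ, ∃ c : ℤ, w₂ ⬝ᵥ M.mulVec (fun i => (z i : ℝ)) = c)
    (hsmall : ∀ k l, |w₁ k * w₂ l - w₁ l * w₂ k| * |M.det| < 1) :
    ∃ z : ι → ℤ, z ≠ 0 ∧
      ∀ k, |M.mulVec (fun i => (z i : ℝ)) k| ≤ (Fintype.card ι : ℝ) ^ 2 := by
  obtain ⟨k', hk'⟩ := Function.ne_iff.1 hw₁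
  obtain ⟨k₀, -, hk₀⟩ := Finset.exists_max_image Finset.univ (fun k => |w₁ k|) ⟨k', Finset.mem_univ _⟩
  have hwk : w₁ k₀ ≠ 0 := abs_pos.1 ((abs_pos.2 hk').trans_le (hk₀ k' (Finset.mem_univ _)))
  -- Gaussian elimination: clearing coordinate `k₀` of `w₂` makes the final determinant a 2×2 minor
  -- times `M.det`.
  set q : ℝ := w₂ k₀ / w₁ k₀ with hq
  set w : ι → ℝ := w₂ - q • w₁ with hw
  have hwk₀ : w k₀ = 0 := by simp [hw, hq, hwk]
  have hw0 : w ≠ 0 := fun h => hw₂ q (sub_eq_zero.1 h)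
  obtain ⟨l', hl'⟩ := Function.ne_iff.1 hw0
  obtain ⟨k₁, -, hk₁⟩ := Finset.exists_max_image Finset.univ (fun k => |w k|) ⟨l', Finset.mem_univ _⟩
  have hwk₁ : w k₁ ≠ 0 := abs_pos.1 ((abs_pos.2 hl').trans_le (hk₁ l' (Finset.mem_univ _)))
  have hne : k₁ ≠ k₀ := by rintro rfl; exact hwk₁ hwk₀
  have hminor : w k₁ * w₁ k₀ = w₁ k₀ * w₂ k₁ - w₁ k₁ * w₂ k₀ := by
    simp only [hw, hq, Pi.sub_apply, Pi.smul_apply, smul_eq_mul]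
    field_simp
  -- Coordinate `k₀` already holds `w₁ ⬝ᵥ v` when this row acts, so the entry `q` turns `w ⬝ᵥ v`
  -- back into `w₂ ⬝ᵥ v`.
  set c : ι → ℝ := Function.update w k₀ q with hc
  have hck : c k₁ = w k₁ := by simp [hc, hne]
  have hdet : ((1 : Matrix ι ι ℝ).updateRow k₁ c * ((1 : Matrix ι ι ℝ).updateRow k₀ w₁ * M)).det
      = w k₁ * w₁ k₀ * M.det := by
    rw [Matrix.det_mul, Matrix.det_mul, det_updateRow_one, det_updateRow_one, hck, mul_assoc]
  obtain ⟨z, hz0, hz⟩ := exists_int_abs_mulVec_lt_one _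
    (by rw [hdet]; exact mul_ne_zero (mul_ne_zero hwk₁ hwk) hM)
    (by rw [hdet, hminor, abs_mul]; exact hsmall k₀ k₁)
  refine ⟨z, hz0, ?_⟩
  have hint₁ := hint₁ z
  have hint₂ := hint₂ z
  simp only [← Matrix.mulVec_mulVec, updateRow_one_mulVec] at hz
  generalize M.mulVec (fun i => (z i : ℝ)) = v at *
  have hcdot : c ⬝ᵥ Function.update v k₀ (w₁ ⬝ᵥ v) = w₂ ⬝ᵥ v := by
    have h1 : c ⬝ᵥ Function.update v k₀ (w₁ ⬝ᵥ v) = w ⬝ᵥ v + q * (w₁ ⬝ᵥ v) := by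
      simp only [dotProduct]
      rw [← Finset.add_sum_erase Finset.univ _ (Finset.mem_univ k₀),
        ← Finset.add_sum_erase Finset.univ (fun k => w k * v k) (Finset.mem_univ k₀), hwk₀]
      rw [Finset.sum_congr rfl (fun k hk => by
        rw [hc, Function.update_of_ne (Finset.ne_of_mem_erase hk),
          Function.update_of_ne (Finset.ne_of_mem_erase hk)] :
          ∀ k ∈ Finset.univ.erase k₀, c k * Function.update v k₀ _ k = w k * v k)]
      simp [hc]
      ring
    rw [h1, hw, sub_dotProduct, smul_dotProduct, smul_eq_mul]
    ring
  have hother : ∀ k, k ≠ k₀ → k ≠ k₁ → |v k| ≤ 1 := fun k hk hk' => by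
    simpa [hk, hk'] using (hz k).le
  have hzero₁ : w₁ ⬝ᵥ v = 0 :=
    eq_zero_of_abs_lt_one_of_int (by simpa [hne.symm] using hz k₀) hint₁
  have hzero₂ : w₂ ⬝ᵥ v = 0 :=
    eq_zero_of_abs_lt_one_of_int (by simpa [hcdot] using hz k₁) hint₂
  have hzero : w ⬝ᵥ v = 0 := by
    rw [hw, sub_dotProduct, smul_dotProduct, hzero₁, hzero₂]; simp
  have hcard := one_le_card_of_index k₀
  have hv₁ : |v k₁| ≤ Fintype.card ι := by
    refine (abs_coord_le_of_dotProduct_eq_zero zero_le_one hzero hwk₁ fun i hi => ?_).trans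
      (by simp)
    by_cases hi₀ : i = k₀
    · simp [hi₀, hwk₀]
    · rw [abs_mul]
      exact mul_le_mul (hk₁ i (Finset.mem_univ _)) (hother i hi₀ hi) (abs_nonneg _) (abs_nonneg _)
  have hv : ∀ k, k ≠ k₀ → |v k| ≤ Fintype.card ι := fun k hk => by
    by_cases hk' : k = k₁
    · rwa [hk']
    · exact (hother k hk hk').trans hcard
  intro k
  by_cases hk : k = k₀
  · subst hk
    refine (abs_coord_le_of_dotProduct_eq_zero (r := Fintype.card ι) (by positivity) hzero₁ hwk fun i hi => ?_).trans
      (by rw [sq])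
    rw [abs_mul]
    exact mul_le_mul (hk₀ i (Finset.mem_univ _)) (hv i hi) (abs_nonneg _) (abs_nonneg _)
  · exact (hv k hk).trans (by nlinarith)

/-- `w` lies in the dual of the lattice `M ℤ^ι`. -/
def IsDualVector {ι : Type*} [Fintype ι] (M : Matrix ι ι ℝ) (w : ι → ℝ) : Prop :=
  ∀ z : ι → ℤ, ∃ c : ℤ, w ⬝ᵥ M.mulVec (fun i => (z i : ℝ)) = c

/-- If every box of a suitable two-parameter family contains a nonzero point of the dual lattice,
then the lattice itself has a short vector. -/
lemma exists_short_of_dual_boxes {κ μ : Type*} [Fintype κ] [Fintype μ] [DecidableEq κ]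
    [DecidableEq μ] (M : Matrix (κ ⊕ μ) (κ ⊕ μ) ℝ) (hM : M.det ≠ 0) {δ : ℝ} (hδ : 0 < δ)
    (hδM : 8 * δ * |M.det| < 1)
    (H : ∀ A B : ℝ, δ < A → δ < B → δ < A * B → ∃ w : κ ⊕ μ → ℝ, w ≠ 0 ∧ IsDualVector M w ∧
      ‖w ∘ Sum.inr‖ < A ∧ ‖w ∘ Sum.inl‖ < B) :
    ∃ z : κ ⊕ μ → ℤ, z ≠ 0 ∧
      ∀ k, |M.mulVec (fun i => (z i : ℝ)) k| ≤ (Fintype.card (κ ⊕ μ) : ℝ) ^ 2 := by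
  have hD : 0 < |M.det| := abs_pos.2 hM
  set δ₀ : ℝ := |M.det|⁻¹ with hδ₀
  have hδ₀pos : 0 < δ₀ := inv_pos.2 hD
  have hδδ₀ : 8 * δ < δ₀ := by rwa [hδ₀, lt_inv_comm₀ (by positivity) hD, ← one_div, lt_div_iff₀
    (by positivity), mul_comm]
  have hcoord : ∀ w : κ ⊕ μ → ℝ, ∀ k, |w k| ≤ max ‖w ∘ Sum.inr‖ ‖w ∘ Sum.inl‖ := by
    rintro w (k | k)
    · exact (norm_le_pi_norm (w ∘ Sum.inl) k).trans (le_max_right _ _)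
    · exact (norm_le_pi_norm (w ∘ Sum.inr) k).trans (le_max_left _ _)
  by_cases hs : ∃ w : κ ⊕ μ → ℝ, w ≠ 0 ∧ IsDualVector M w ∧ ‖w ∘ Sum.inr‖ < δ₀ ∧ ‖w ∘ Sum.inl‖ < δ₀
  · obtain ⟨w, hw0, hw, h1, h2⟩ := hs
    refine exists_short_of_dual M hM w hw0 hw fun k => ?_
    rw [← lt_div_iff₀ hD, one_div]
    exact (hcoord w k).trans_lt (max_lt h1 h2)
  have hs' : ∀ w : κ ⊕ μ → ℝ, w ≠ 0 → IsDualVector M w →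
      δ₀ ≤ ‖w ∘ Sum.inr‖ ∨ δ₀ ≤ ‖w ∘ Sum.inl‖ := by
    intro w hw0 hw
    by_contra! h
    exact hs ⟨w, hw0, hw, h.1, h.2⟩
  -- Dual vectors are classed by their dominant block. The infima need not be attained: near-minimal
  -- vectors within a factor 2 suffice, whence `4 * δ` per product and `8 * δ` per minor.
  let SA : Set ℝ := {r | ∃ w : κ ⊕ μ → ℝ, w ≠ 0 ∧ IsDualVector M w ∧
    ‖w ∘ Sum.inl‖ ≤ ‖w ∘ Sum.inr‖ ∧ r = ‖w ∘ Sum.inr‖}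
  let SB : Set ℝ := {r | ∃ w : κ ⊕ μ → ℝ, w ≠ 0 ∧ IsDualVector M w ∧
    ‖w ∘ Sum.inr‖ < ‖w ∘ Sum.inl‖ ∧ r = ‖w ∘ Sum.inl‖}
  have hSAne : SA.Nonempty := by
    obtain ⟨w, hw0, hw, -, hB⟩ := H (δ + 2) δ₀ (by linarith) (by linarith) (by nlinarith)
    have := (hs' w hw0 hw).resolve_right hB.not_ge
    exact ⟨_, w, hw0, hw, by linarith, rfl⟩
  have hSBne : SB.Nonempty := by
    obtain ⟨w, hw0, hw, hA, -⟩ := H δ₀ (δ + 2) (by linarith) (by linarith) (by nlinarith)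
    have := (hs' w hw0 hw).resolve_left hA.not_ge
    exact ⟨_, w, hw0, hw, by linarith, rfl⟩
  have hSAlb : ∀ r ∈ SA, δ₀ ≤ r := by
    rintro r ⟨w, hw0, hw, hle, rfl⟩
    rcases hs' w hw0 hw with h | h <;> linarith
  have hSBlb : ∀ r ∈ SB, δ₀ ≤ r := by
    rintro r ⟨w, hw0, hw, hle, rfl⟩
    rcases hs' w hw0 hw with h | h <;> linarith
  have hA : δ₀ ≤ sInf SA := le_csInf hSAne hSAlb
  have hB : δ₀ ≤ sInf SB := le_csInf hSBne hSBlb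
  by_cases hAB : sInf SA * sInf SB ≤ δ
  · obtain ⟨_, ⟨w₂, hw₂0, hw₂, hle₂, rfl⟩, hlt₂⟩ :=
      exists_lt_of_csInf_lt hSAne (by linarith : sInf SA < 2 * sInf SA)
    obtain ⟨_, ⟨w₁, hw₁0, hw₁, hle₁, rfl⟩, hlt₁⟩ :=
      exists_lt_of_csInf_lt hSBne (by linarith : sInf SB < 2 * sInf SB)
    refine exists_short_of_dual_pair M hM w₁ w₂ hw₁0 ?_ hw₁ hw₂ fun k l => ?_
    -- A nonzero scalar preserves which block dominates, and `w₁`, `w₂` differ in this.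
    · rintro c rfl
      have hc : c ≠ 0 := by rintro rfl; simp at hw₂0
      have e1 : (c • w₁) ∘ Sum.inl = c • (w₁ ∘ (Sum.inl : κ → κ ⊕ μ)) := rfl
      have e2 : (c • w₁) ∘ Sum.inr = c • (w₁ ∘ (Sum.inr : μ → κ ⊕ μ)) := rfl
      rw [e1, e2, norm_smul, norm_smul] at hle₂
      exact (mul_lt_mul_of_pos_left hle₁ (norm_pos_iff.2 hc)).not_ge hle₂
    · have c1 : ∀ k, |w₁ k| ≤ 2 * sInf SB := fun k =>
        ((hcoord w₁ k).trans (max_le hle₁.le le_rfl)).trans hlt₁.le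
      have c2 : ∀ k, |w₂ k| ≤ 2 * sInf SA := fun k =>
        ((hcoord w₂ k).trans (max_le le_rfl hle₂)).trans hlt₂.le
      have c3 : ∀ k l, |w₁ k * w₂ l| ≤ 4 * δ := fun k l => by
        rw [abs_mul]
        calc _ ≤ (2 * sInf SB) * (2 * sInf SA) :=
              mul_le_mul (c1 k) (c2 l) (abs_nonneg _) (by linarith)
          _ ≤ _ := by linarith
      have c4 : |w₁ k * w₂ l - w₁ l * w₂ k| ≤ 8 * δ :=
        (abs_sub _ _).trans (by linarith [c3 k l, c3 l k])
      exact (mul_le_mul_of_nonneg_right c4 hD.le).trans_lt hδM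
  -- The boxes are open, so a dual vector in this one would undercut the infimum of its own class.
  · obtain ⟨w, hw0, hw, hwA, hwB⟩ := H _ _ (by linarith) (by linarith) (not_le.1 hAB)
    exfalso
    rcases le_or_gt ‖w ∘ Sum.inl‖ ‖w ∘ Sum.inr‖ with h | h
    · exact hwA.not_ge (csInf_le ⟨δ₀, hSAlb⟩ ⟨w, hw0, hw, h, rfl⟩)
    · exact hwB.not_ge (csInf_le ⟨δ₀, hSBlb⟩ ⟨w, hw0, hw, h, rfl⟩)

/-! ### The weighted system as a lattice problem -/

lemma weightedNorm_le_iff {k : ℕ} (hk : 0 < k) {w : Fin k → ℝ} (hw : ∀ j, 0 < w j)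
    (x : Fin k → ℝ) {r : ℝ} (hr : 0 ≤ r) :
    weightedNorm w x ≤ r ↔ ∀ j, |x j| ≤ r ^ w j := by
  have : Nonempty (Fin k) := ⟨⟨0, hk⟩⟩
  have h : weightedNorm w x ≤ r ↔ ∀ j, |x j| ^ (1 / w j) ≤ r :=
    ciSup_le_iff (Set.finite_range _).bddAbove
  rw [h]
  refine forall_congr' fun j => ?_
  rw [one_div, Real.rpow_inv_le_iff_of_pos (abs_nonneg _) hr (hw j)]

/-- The linear forms `x` and `Θ x - y` of the vector `(x, y)`, divided by the scales `c`. -/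
noncomputable def formMatrix {m n : ℕ} (Θ : Matrix (Fin n) (Fin m) ℝ) (c : Fin m ⊕ Fin n → ℝ) :
    Matrix (Fin m ⊕ Fin n) (Fin m ⊕ Fin n) ℝ :=
  Matrix.diagonal (fun k => (c k)⁻¹) * Matrix.fromBlocks 1 0 Θ (-1)

lemma abs_det_formMatrix {m n : ℕ} (Θ : Matrix (Fin n) (Fin m) ℝ) {c : Fin m ⊕ Fin n → ℝ}
    (hc : ∀ k, 0 < c k) : |(formMatrix Θ c).det| = (∏ k, c k)⁻¹ := by
  have h : |(-1 : Matrix (Fin n) (Fin n) ℝ).det| = 1 := by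
    simp [Matrix.det_neg]
  rw [formMatrix, Matrix.det_mul, Matrix.det_diagonal, Matrix.det_fromBlocks_zero₁₂,
    Matrix.det_one, one_mul, abs_mul, h, mul_one, Finset.prod_inv_distrib, abs_of_pos]
  exact inv_pos.2 (Finset.prod_pos fun k _ => hc k)

lemma formMatrix_mulVec_inl {m n : ℕ} (Θ : Matrix (Fin n) (Fin m) ℝ) (c z : Fin m ⊕ Fin n → ℝ)
    (j : Fin m) : (formMatrix Θ c).mulVec z (Sum.inl j) = (c (Sum.inl j))⁻¹ * z (Sum.inl j) := by
  rw [formMatrix, ← Matrix.mulVec_mulVec, Matrix.mulVec_diagonal, Matrix.fromBlocks_mulVec]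
  simp

lemma formMatrix_mulVec_inr {m n : ℕ} (Θ : Matrix (Fin n) (Fin m) ℝ) (c z : Fin m ⊕ Fin n → ℝ)
    (i : Fin n) : (formMatrix Θ c).mulVec z (Sum.inr i) =
      (c (Sum.inr i))⁻¹ * (Θ.mulVec (fun j => z (Sum.inl j)) i - z (Sum.inr i)) := by
  rw [formMatrix, ← Matrix.mulVec_mulVec, Matrix.mulVec_diagonal, Matrix.fromBlocks_mulVec]
  simp [Matrix.neg_mulVec, sub_eq_add_neg, Function.comp_def]

/-- The forms `b - ᵗΘ a` and `a`, dual to those of `formMatrix`. -/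
noncomputable def dualForm {m n : ℕ} (Θ : Matrix (Fin n) (Fin m) ℝ) (c : Fin m ⊕ Fin n → ℝ)
    (a : Fin n → ℤ) (b : Fin m → ℤ) : Fin m ⊕ Fin n → ℝ :=
  fun k => c k * Sum.elim (fun j => (b j : ℝ) - Θ.transpose.mulVec (fun i => (a i : ℝ)) j)
    (fun i => (a i : ℝ)) k

lemma isDualVector_dualForm {m n : ℕ} (Θ : Matrix (Fin n) (Fin m) ℝ) {c : Fin m ⊕ Fin n → ℝ}
    (hc : ∀ k, 0 < c k) (a : Fin n → ℤ) (b : Fin m → ℤ) :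
    IsDualVector (formMatrix Θ c) (dualForm Θ c a b) := by
  intro z
  refine ⟨∑ j, b j * z (Sum.inl j) - ∑ i, a i * z (Sum.inr i), ?_⟩
  have hadj : (Θ.transpose.mulVec fun i => (a i : ℝ)) ⬝ᵥ (fun j => (z (Sum.inl j) : ℝ)) =
      (fun i => (a i : ℝ)) ⬝ᵥ Θ.mulVec fun j => (z (Sum.inl j) : ℝ) := by
    rw [Matrix.mulVec_transpose, Matrix.dotProduct_mulVec]
  have hj : ∀ j, dualForm Θ c a b (Sum.inl j) *
      (formMatrix Θ c).mulVec (fun k => (z k : ℝ)) (Sum.inl j) =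
      b j * z (Sum.inl j) - Θ.transpose.mulVec (fun i => (a i : ℝ)) j * z (Sum.inl j) := by
    intro j
    rw [formMatrix_mulVec_inl, dualForm]
    have := (hc (Sum.inl j)).ne'
    field_simp
    simp only [Sum.elim_inl]
    ring
  have hi : ∀ i, dualForm Θ c a b (Sum.inr i) *
      (formMatrix Θ c).mulVec (fun k => (z k : ℝ)) (Sum.inr i) =
      a i * Θ.mulVec (fun j => (z (Sum.inl j) : ℝ)) i - a i * z (Sum.inr i) := by
    intro i
    rw [formMatrix_mulVec_inr, dualForm]
    have := (hc (Sum.inr i)).ne'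
    field_simp
    simp only [Sum.elim_inr]
    ring
  rw [dotProduct, Fintype.sum_sum_type]
  simp only [hj, hi, Finset.sum_sub_distrib]
  simp only [dotProduct] at hadj
  rw [hadj]
  push_cast
  ring

lemma dualForm_ne_zero {m n : ℕ} (Θ : Matrix (Fin n) (Fin m) ℝ) {c : Fin m ⊕ Fin n → ℝ}
    (hc : ∀ k, 0 < c k) {a : Fin n → ℤ} {b : Fin m → ℤ} (h : (a, b) ≠ (0, 0)) :
    dualForm Θ c a b ≠ 0 := by
  intro h0
  have h1 : ∀ k, _ := fun k => (mul_eq_zero.1 (congrFun h0 k)).resolve_left (hc k).ne'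
  have ha : a = 0 := funext fun i => by simpa using h1 (Sum.inr i)
  subst ha
  have hb : b = 0 := funext fun j => by
    have := h1 (Sum.inl j)
    simpa [Matrix.mulVec, dotProduct] using this
  exact h (by rw [hb])

/-- The scales `s ^ σ_j` and `s ^ (-β ρ_i)`, divided by `C`. -/
noncomputable def scale {m n : ℕ} (σ : Fin m → ℝ) (ρ : Fin n → ℝ) (β C s : ℝ) : Fin m ⊕ Fin n → ℝ :=
  Sum.elim (fun j => s ^ σ j / C) (fun i => s ^ (-β * ρ i) / C)

lemma scale_pos {m n : ℕ} (σ : Fin m → ℝ) (ρ : Fin n → ℝ) (β : ℝ) {C s : ℝ} (hC : 0 < C)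
    (hs : 0 < s) (k : Fin m ⊕ Fin n) : 0 < scale σ ρ β C s k := by
  rcases k with k | k <;> simp only [scale, Sum.elim_inl, Sum.elim_inr] <;> positivity

lemma prod_scale {m n : ℕ} {σ : Fin m → ℝ} {ρ : Fin n → ℝ} (hσ : ∑ j, σ j = 1)
    (hρ : ∑ i, ρ i = 1) (β C : ℝ) {s : ℝ} (hs : 0 < s) :
    ∏ k, scale σ ρ β C s k = s ^ (1 - β) / C ^ (m + n) := by
  simp only [Fintype.prod_sum_type, scale, Sum.elim_inl, Sum.elim_inr, Finset.prod_div_distrib,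
    Finset.prod_const, Finset.card_univ, Fintype.card_fin]
  rw [← Real.rpow_sum_of_pos hs, ← Real.rpow_sum_of_pos hs, ← Finset.mul_sum, hσ, hρ,
    div_mul_div_comm, ← Real.rpow_add hs, pow_add]
  ring_nf

/-- The divisor `C` in the scales cancels the bound `C` on the coordinates, so no constant is lost.
-/
lemma hasNonzeroSolution_of_formMatrix {m n : ℕ} (hm : 0 < m) (hn : 0 < n) {σ : Fin m → ℝ}
    {ρ : Fin n → ℝ} (hσ : ∀ j, 0 < σ j) (hρ : ∀ i, 0 < ρ i) (Θ : Matrix (Fin n) (Fin m) ℝ)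
    {β C s : ℝ} (hC : 0 < C) (hs : 0 < s) {z : Fin m ⊕ Fin n → ℤ} (hz0 : z ≠ 0)
    (hz : ∀ k, |(formMatrix Θ (scale σ ρ β C s)).mulVec (fun k => (z k : ℝ)) k| ≤ C) :
    HasNonzeroSolution σ ρ Θ β s := by
  have hpos := scale_pos σ ρ β hC hs
  refine ⟨fun j => z (Sum.inl j), fun i => z (Sum.inr i), ?_, ?_, ?_⟩
  · intro h
    rw [Prod.mk.injEq] at h
    refine hz0 (funext fun k => ?_)
    rcases k with k | k
    · exact congrFun h.1 k
    · exact congrFun h.2 k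
  · rw [weightedNorm_le_iff hm hσ _ hs.le]
    intro j
    have h := hz (Sum.inl j)
    rw [formMatrix_mulVec_inl, abs_mul, abs_inv, abs_of_pos (hpos _),
      inv_mul_le_iff₀ (hpos _)] at h
    simpa [scale, hC.ne'] using h
  · rw [weightedNorm_le_iff hn hρ _ (Real.rpow_nonneg hs.le _)]
    intro i
    have h := hz (Sum.inr i)
    rw [formMatrix_mulVec_inr, abs_mul, abs_inv, abs_of_pos (hpos _),
      inv_mul_le_iff₀ (hpos _)] at h
    rw [← Real.rpow_mul hs.le]
    simpa [scale, hC.ne'] using h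

/-- Minkowski's bound: every exponent below `1` is uniformly attained. -/
lemma hasNonzeroSolution_of_lt_one {m n : ℕ} (hm : 0 < m) (hn : 0 < n) {σ : Fin m → ℝ}
    {ρ : Fin n → ℝ} (hσ : IsWeight σ) (hρ : IsWeight ρ) (Θ : Matrix (Fin n) (Fin m) ℝ)
    {β s : ℝ} (hβ : β < 1) (hs : 1 < s) : HasNonzeroSolution σ ρ Θ β s := by
  have hs0 : 0 < s := zero_lt_one.trans hs
  have hdet := abs_det_formMatrix Θ (scale_pos σ ρ β zero_lt_one hs0)
  rw [prod_scale hσ.sum_eq_one hρ.sum_eq_one β 1 hs0, one_pow, div_one] at hdet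
  obtain ⟨z, hz0, hz⟩ := exists_int_abs_mulVec_lt_one _
    (abs_pos.1 (hdet ▸ inv_pos.2 (Real.rpow_pos_of_pos hs0 _)))
    (hdet ▸ inv_lt_one_of_one_lt₀ (Real.one_lt_rpow hs (by linarith)))
  exact hasNonzeroSolution_of_formMatrix hm hn hσ.pos hρ.pos Θ zero_lt_one hs0 hz0
    fun k => (hz k).le

/-! ### The transference principle -/

/-- A choice of an exponent `τ` for which the dual system at `s ^ τ` is small enough. -/
lemma exists_exponent {α β η σ₀ ρ₀ x y : ℝ} (hα : 0 < α) (hη : 0 < η) (hσ₀ : 0 < σ₀)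
    (hρ₀ : 0 < ρ₀) (h1 : η ≤ σ₀ * (α * β - 1)) (h2 : α * η ≤ ρ₀ * (α * β - 1))
    (hx : -η < x) (hy : -η < y) (hxy : -η < x + y) :
    ∃ τ, 1 / α ≤ τ ∧ τ ≤ β ∧ (τ - β) * ρ₀ < x ∧ (1 - α * τ) * σ₀ < y := by
  -- As `τ` runs over `[1/α, β]`, the point `((τ - β) * ρ₀, (1 - α * τ) * σ₀)` traces a segment
  -- joining the negative half-axes, with intercepts at most `-η` by `h2` and `h1`. It stays on or
  -- below the line of sum `-η`, so some point of it lies strictly below `(x, y)` in both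
  -- coordinates.
  set b := max 0 (-x)
  set a := max 0 (-y)
  have hab : a + b < η := by
    rcases max_cases 0 (-x) with h | h <;> rcases max_cases 0 (-y) with h' | h' <;>
      simp only [a, b] <;> linarith
  have ha : 0 ≤ a := le_max_left _ _
  have hb : 0 ≤ b := le_max_left _ _
  have hax : -y ≤ a := le_max_right _ _
  have hbx : -x ≤ b := le_max_right _ _
  set ε := (η - a - b) / 2 with hε
  have hεpos : 0 < ε := by rw [hε]; linarith
  have h3 : (a + ε) / σ₀ + α * (b + ε) / ρ₀ ≤ α * β - 1 := by
    have e1 : (a + ε) / σ₀ ≤ (a + ε) / η * (α * β - 1) := by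
      rw [div_mul_eq_mul_div, div_le_div_iff₀ hσ₀ hη]
      nlinarith
    have e2 : α * (b + ε) / ρ₀ ≤ (b + ε) / η * (α * β - 1) := by
      rw [div_mul_eq_mul_div, div_le_div_iff₀ hρ₀ hη]
      nlinarith
    have e3 : (a + ε) / η * (α * β - 1) + (b + ε) / η * (α * β - 1) = α * β - 1 := by
      rw [← add_mul, ← add_div, show a + ε + (b + ε) = η by rw [hε]; ring, div_self hη.ne', one_mul]
    linarith
  have h4 : 0 ≤ (a + ε) / σ₀ := by positivity
  have h5 : 0 ≤ (b + ε) / ρ₀ := by positivity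
  have h6 : α * ((1 + (a + ε) / σ₀) / α) = 1 + (a + ε) / σ₀ := by field_simp
  have h7 : (b + ε) / ρ₀ ≤ β - (1 + (a + ε) / σ₀) / α := by
    rw [mul_div_assoc] at h3
    have : α * ((b + ε) / ρ₀) ≤ α * (β - (1 + (a + ε) / σ₀) / α) := by
      rw [mul_sub, h6]; linarith
    exact le_of_mul_le_mul_left this hα
  -- This `τ` solves `(1 - α * τ) * σ₀ = -(a + ε)`.
  refine ⟨(1 + (a + ε) / σ₀) / α, ?_, by linarith, ?_, ?_⟩
  · exact div_le_div_of_nonneg_right (by linarith) hα.le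
  · rw [div_le_iff₀ hρ₀] at h7
    linarith
  · rw [h6, show (1 - (1 + (a + ε) / σ₀)) * σ₀ = -(a + ε) by field_simp; ring]
    linarith

/-- The uniform transference principle. -/
lemma hasNonzeroSolution_of_transpose {m n : ℕ} (hm : 0 < m) (hn : 0 < n) {σ : Fin m → ℝ}
    {ρ : Fin n → ℝ} (hσ : IsWeight σ) (hρ : IsWeight ρ) {σ₀ ρ₀ : ℝ} (hσ₀ : 0 < σ₀) (hρ₀ : 0 < ρ₀)
    (hσle : ∀ j, σ₀ ≤ σ j) (hρle : ∀ i, ρ₀ ≤ ρ i) (Θ : Matrix (Fin n) (Fin m) ℝ)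
    {α β η : ℝ} (hα : 0 < α) (hη : 0 < η) (hβη : β - 1 < η) (h1 : η ≤ σ₀ * (α * β - 1))
    (h2 : α * η ≤ ρ₀ * (α * β - 1))
    (hT : ∃ T : ℝ, ∀ t : ℝ, T ≤ t → HasNonzeroSolution ρ σ Θ.transpose α t) :
    ∃ S : ℝ, ∀ s : ℝ, S ≤ s → HasNonzeroSolution σ ρ Θ β s := by
  obtain ⟨T, hT⟩ := hT
  set C : ℝ := (Fintype.card (Fin m ⊕ Fin n) : ℝ) ^ 2
  have hC1 : 1 ≤ C := one_le_pow₀ (one_le_card_of_index (Sum.inl ⟨0, hm⟩))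
  have hC : 0 < C := zero_lt_one.trans_le hC1
  -- The determinant is `C ^ (m + n) * s ^ (β - 1)` and the boxes have `δ = s ^ (-η)`; the gap `β -
  -- 1 < η` absorbs all constants.
  have hlim : Filter.Tendsto (fun s : ℝ => 8 * C ^ (m + n) * s ^ (-(η - (β - 1))))
      Filter.atTop (nhds 0) := by
    simpa using (tendsto_rpow_neg_atTop (sub_pos.2 hβη)).const_mul (8 * C ^ (m + n))
  have hev := (hlim.eventually_lt_const zero_lt_one).and
    (((tendsto_rpow_atTop (one_div_pos.2 hα)).eventually_ge_atTop T).and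
      (Filter.eventually_gt_atTop 1))
  rw [Filter.eventually_atTop] at hev
  obtain ⟨S, hS⟩ := hev
  refine ⟨S, fun s hs => ?_⟩
  obtain ⟨hs8, hsT, hs1⟩ := hS s hs
  have hs0 : 0 < s := zero_lt_one.trans hs1
  have hpos := scale_pos σ ρ β hC hs0
  have hdet := abs_det_formMatrix Θ hpos
  rw [prod_scale hσ.sum_eq_one hρ.sum_eq_one β C hs0, inv_div] at hdet
  have hdet0 : (formMatrix Θ (scale σ ρ β C s)).det ≠ 0 := abs_pos.1 (hdet ▸ by positivity)
  have hδM : 8 * s ^ (-η) * |(formMatrix Θ (scale σ ρ β C s)).det| < 1 := by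
    rw [hdet]
    calc 8 * s ^ (-η) * (C ^ (m + n) / s ^ (1 - β))
        = 8 * C ^ (m + n) * s ^ (-(η - (β - 1))) := by
          rw [show -(η - (β - 1)) = -η - (1 - β) by ring, Real.rpow_sub hs0 (-η)]
          ring
      _ < 1 := hs8
  suffices H : _ by
    obtain ⟨z, hz0, hz⟩ :=
      exists_short_of_dual_boxes _ hdet0 (Real.rpow_pos_of_pos hs0 (-η)) hδM H
    exact hasNonzeroSolution_of_formMatrix hm hn hσ.pos hρ.pos Θ hC hs0 hz0 hz
  intro A B hA hB hAB
  have hδ : 0 < s ^ (-η) := Real.rpow_pos_of_pos hs0 _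
  have hA0 : 0 < A := hδ.trans hA
  have hB0 : 0 < B := hδ.trans hB
  rw [← Real.lt_logb_iff_rpow_lt hs1 hA0] at hA
  rw [← Real.lt_logb_iff_rpow_lt hs1 hB0] at hB
  rw [← Real.lt_logb_iff_rpow_lt hs1 (mul_pos hA0 hB0), Real.logb_mul hA0.ne' hB0.ne'] at hAB
  obtain ⟨τ, hτ1, hτ2, hτ3, hτ4⟩ := exists_exponent hα hη hσ₀ hρ₀ h1 h2 hA hB hAB
  rw [Real.lt_logb_iff_rpow_lt hs1 hA0] at hτ3
  rw [Real.lt_logb_iff_rpow_lt hs1 hB0] at hτ4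
  have ht : T ≤ s ^ τ := hsT.trans (Real.rpow_le_rpow_of_exponent_le hs1.le hτ1)
  obtain ⟨a, b, hab, ha, hb⟩ := hT _ ht
  have ht0 : 0 ≤ s ^ τ := Real.rpow_nonneg hs0.le _
  rw [weightedNorm_le_iff hn hρ.pos _ ht0] at ha
  rw [weightedNorm_le_iff hm hσ.pos _ (Real.rpow_nonneg ht0 _)] at hb
  refine ⟨_, dualForm_ne_zero Θ hpos hab, isDualVector_dualForm Θ hpos a b, ?_, ?_⟩
  · rw [pi_norm_lt_iff hA0]
    intro i
    refine lt_of_le_of_lt ?_ hτ3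
    have h := ha i
    rw [← Real.rpow_mul hs0.le] at h
    simp only [Function.comp, dualForm, scale, Sum.elim_inr, Real.norm_eq_abs]
    rw [abs_mul, abs_of_pos (by positivity)]
    calc s ^ (-β * ρ i) / C * |(a i : ℝ)| ≤ s ^ (-β * ρ i) * s ^ (τ * ρ i) :=
          mul_le_mul (div_le_self (by positivity) hC1) h (abs_nonneg _) (by positivity)
      _ = s ^ ((τ - β) * ρ i) := by rw [← Real.rpow_add hs0]; ring_nf
      -- Since `τ ≤ β`, the smallest weight is the worst case.
      _ ≤ _ := Real.rpow_le_rpow_of_exponent_le hs1.le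
          (mul_le_mul_of_nonpos_left (hρle i) (by linarith))
  · rw [pi_norm_lt_iff hB0]
    intro j
    refine lt_of_le_of_lt ?_ hτ4
    have h := hb j
    rw [← Real.rpow_mul hs0.le, ← Real.rpow_mul hs0.le, abs_sub_comm] at h
    simp only [Function.comp, dualForm, scale, Sum.elim_inl, Real.norm_eq_abs]
    rw [abs_mul, abs_of_pos (by positivity)]
    have hατ : 1 ≤ α * τ := by rwa [div_le_iff₀' hα] at hτ1
    calc s ^ σ j / C * _ ≤ s ^ σ j * s ^ (τ * -α * σ j) :=
          mul_le_mul (div_le_self (by positivity) hC1) h (abs_nonneg _) (by positivity)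
      _ = s ^ ((1 - α * τ) * σ j) := by rw [← Real.rpow_add hs0]; ring_nf
      _ ≤ _ := Real.rpow_le_rpow_of_exponent_le hs1.le
          (mul_le_mul_of_nonpos_left (hσle j) (by linarith))

/-! ### Passage to the exponents -/

lemma le_uniformExponent {m n : ℕ} {σ : Fin m → ℝ} {ρ : Fin n → ℝ}
    {Θ : Matrix (Fin n) (Fin m) ℝ} {γ : ℝ}
    (h : ∃ T : ℝ, ∀ t : ℝ, T ≤ t → HasNonzeroSolution σ ρ Θ γ t) :
    (γ : EReal) ≤ uniformExponent σ ρ Θ :=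
  le_sSup ⟨γ, h, rfl⟩

lemma one_le_uniformExponent {m n : ℕ} (hm : 0 < m) (hn : 0 < n) {σ : Fin m → ℝ}
    {ρ : Fin n → ℝ} (hσ : IsWeight σ) (hρ : IsWeight ρ) (Θ : Matrix (Fin n) (Fin m) ℝ) :
    1 ≤ uniformExponent σ ρ Θ := by
  refine EReal.ge_of_forall_gt_iff_ge.1 fun γ hγ => ?_
  refine le_uniformExponent ⟨2, fun t ht => ?_⟩
  exact hasNonzeroSolution_of_lt_one hm hn hσ hρ Θ (by exact_mod_cast hγ) (by linarith)

/-- The transference principle, for exponents: strict inequalities at `w` contradict that `w` is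
the uniform exponent. -/
lemma uniformExponent_ne_of_transpose {m n : ℕ} (hm : 0 < m) (hn : 0 < n) {σ : Fin m → ℝ}
    {ρ : Fin n → ℝ} (hσ : IsWeight σ) (hρ : IsWeight ρ) {σ₀ ρ₀ : ℝ} (hσ₀ : 0 < σ₀) (hρ₀ : 0 < ρ₀)
    (hσle : ∀ j, σ₀ ≤ σ j) (hρle : ∀ i, ρ₀ ≤ ρ i) (Θ : Matrix (Fin n) (Fin m) ℝ)
    {α w : ℝ} (hw : 1 ≤ w) (hα : 0 < α) (h1 : w - 1 < σ₀ * (α * w - 1))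
    (h2 : α * (w - 1) < ρ₀ * (α * w - 1))
    (hT : ∃ T : ℝ, ∀ t : ℝ, T ≤ t → HasNonzeroSolution ρ σ Θ.transpose α t) :
    uniformExponent σ ρ Θ ≠ w := by
  intro hω
  -- Strict inequalities at `w` persist for `β` slightly above `w`.
  have hev : ∀ᶠ β in nhdsWithin w (Set.Ioi w),
      β - 1 < σ₀ * (α * β - 1) ∧ α * (β - 1) < ρ₀ * (α * β - 1) := by
    refine nhdsWithin_le_nhds (Filter.Eventually.and ?_ ?_)
    · exact ContinuousAt.eventually_lt (by fun_prop) (by fun_prop) h1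
    · exact ContinuousAt.eventually_lt (by fun_prop) (by fun_prop) h2
  obtain ⟨β, ⟨hβ1, hβ2⟩, hβw⟩ := (hev.and self_mem_nhdsWithin).exists
  have hβw : w < β := hβw
  have hpos : 0 < α * β - 1 := by
    by_contra! h
    nlinarith
  have hle := le_uniformExponent (hasNonzeroSolution_of_transpose hm hn hσ hρ hσ₀ hρ₀ hσle hρle Θ
    (β := β) (η := min (σ₀ * (α * β - 1)) (ρ₀ * (α * β - 1) / α)) hα
    (lt_min (by positivity) (by positivity))
    (lt_min hβ1 (by rwa [lt_div_iff₀ hα, mul_comm])) (min_le_left _ _)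
    (by rw [mul_comm, ← le_div_iff₀ hα]; exact min_le_right _ _) hT)
  rw [hω, EReal.coe_le_coe_iff] at hle
  linarith

lemma IsWeight.le_one {k : ℕ} {w : Fin k → ℝ} (hw : IsWeight w) (j : Fin k) : w j ≤ 1 := by
  rw [← hw.sum_eq_one]
  exact Finset.single_le_sum (fun i _ => (hw.pos i).le) (Finset.mem_univ j)

lemma IsWeight.last_le {k : ℕ} (hk : 1 ≤ k) {w : Fin k → ℝ} (hw : IsWeight w) (j : Fin k) :
    w ⟨k - 1, by omega⟩ ≤ w j :=
  hw.antitone (Fin.mk_le_mk.2 (by omega) : j ≤ ⟨k - 1, by omega⟩)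

theorem mainTheorem5 (m n : ℕ) (hm : 1 ≤ m) (hn : 1 ≤ n) (hmn : 3 ≤ m + n)
    (σ : Fin m → ℝ) (ρ : Fin n → ℝ) (hσ : IsWeight σ) (hρ : IsWeight ρ)
    (Θ : Matrix (Fin n) (Fin m) ℝ)
    (σm ρn : ℝ) (hσm : σm = σ ⟨m - 1, by omega⟩) (hρn : ρn = ρ ⟨n - 1, by omega⟩)
    (ω ωt : EReal) (hω : ω = uniformExponent σ ρ Θ)
    (hωt : ωt = uniformExponent ρ σ Θ.transpose)
    (hlt : ω < extQuotient 1 (1 - ρn)) :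
    (extQuotient (1 - σm) (1 - ρn) ≤ ω →
      ωt ≤ (ρn : EReal) / (1 - (1 - (ρn : EReal)) * ω)) ∧
    (ω ≤ extQuotient (1 - σm) (1 - ρn) →
      ωt ≤ (1 - (1 - (σm : EReal)) * ω⁻¹) / (σm : EReal)) := by
  have hσ0 : 0 < σm := hσm ▸ hσ.pos _
  have hρ0 : 0 < ρn := hρn ▸ hρ.pos _
  have hσle : ∀ j, σm ≤ σ j := fun j => hσm ▸ hσ.last_le hm j
  have hρle : ∀ i, ρn ≤ ρ i := fun i => hρn ▸ hρ.last_le hn i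
  have hρ1 : ρn ≤ 1 := hρn ▸ hρ.le_one _
  have hω1 : 1 ≤ ω := hω ▸ one_le_uniformExponent hm hn hσ hρ Θ
  lift ω to ℝ using ⟨(hlt.trans_le le_top).ne, ne_bot_of_le_ne_bot (by decide) hω1⟩ with w
  have hw : 1 ≤ w := by exact_mod_cast hω1
  have hden : 0 < 1 - (1 - ρn) * w := by
    rcases eq_or_lt_of_le hρ1 with h | h
    · simp [h]
    · rw [extQuotient, if_neg (by linarith), EReal.coe_lt_coe_iff, lt_div_iff₀ (by linarith)] at hlt
      linarith
  have key : ∀ c : ℝ, (∀ α : ℝ, c < α → 0 < α → w - 1 < σm * (α * w - 1) ∧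
      α * (w - 1) < ρn * (α * w - 1)) → 0 ≤ c → ωt ≤ c := by
    intro c hc hc0
    by_contra! h
    rw [hωt, uniformExponent, lt_sSup_iff] at h
    obtain ⟨_, ⟨α, hα, rfl⟩, hcα⟩ := h
    have hcα : c < α := EReal.coe_lt_coe_iff.1 hcα
    obtain ⟨h1, h2⟩ := hc α hcα (hc0.trans_lt hcα)
    exact uniformExponent_ne_of_transpose hm hn hσ hρ hσ0 hρ0 hσle hρle Θ hw (hc0.trans_lt hcα)
      h1 h2 hα hω.symm
  -- Solved for `α`, the inequalities in `key` read `α > (w - 1 + σm) / (σm * w)` and `α > ρn / (1 -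
  -- (1 - ρn) * w)`. As `w ≥ 1`, the identity compares these thresholds through the sign of `(1 -
  -- ρn) * w - (1 - σm)`.
  have hid : (w - 1 + σm) * (1 - (1 - ρn) * w) + (w - 1) * ((1 - ρn) * w - (1 - σm)) =
      ρn * (σm * w) := by ring
  have hw0 : 0 < w := by linarith
  constructor
  · intro h
    have hcase : 1 - σm ≤ (1 - ρn) * w := by
      rcases eq_or_lt_of_le hρ1 with h' | h'
      -- For `ρn = 1` the case threshold is `⊤`, which a real `w` cannot reach.
      · rw [extQuotient, if_pos (by linarith), top_le_iff] at h
        exact absurd h (EReal.coe_ne_top w)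
      · rw [extQuotient, if_neg (by linarith), EReal.coe_le_coe_iff, div_le_iff₀ (by linarith)] at h
        linarith
    have hconv : (ρn : EReal) / (1 - (1 - (ρn : EReal)) * (w : EReal)) =
        ((ρn / (1 - (1 - ρn) * w) : ℝ) : EReal) := rfl
    rw [hconv]
    refine key _ (fun α hα hα0 => ?_) (by positivity)
    rw [div_lt_iff₀ hden] at hα
    refine ⟨?_, by nlinarith⟩
    have : (w - 1 + σm) * (1 - (1 - ρn) * w) < (α * (σm * w)) * (1 - (1 - ρn) * w) := by
      have h1 : 0 ≤ (w - 1) * ((1 - ρn) * w - (1 - σm)) :=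
        mul_nonneg (by linarith) (by linarith)
      have h2 := mul_lt_mul_of_pos_right hα (mul_pos hσ0 hw0)
      linarith
    have := lt_of_mul_lt_mul_right this hden.le
    linarith
  · intro h
    have hcase : (1 - ρn) * w ≤ 1 - σm := by
      rcases eq_or_lt_of_le hρ1 with h' | h'
      · have : σm ≤ 1 := hσm ▸ hσ.le_one _
        simp [h', this]
      · rw [extQuotient, if_neg (by linarith), EReal.coe_le_coe_iff, le_div_iff₀ (by linarith)] at h
        linarith
    have hconv : (1 - (1 - (σm : EReal)) * (w : EReal)⁻¹) / (σm : EReal) =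
        (((1 - (1 - σm) * w⁻¹) / σm : ℝ) : EReal) := rfl
    have hrw : (1 - (1 - σm) * w⁻¹) / σm = (w - 1 + σm) / (σm * w) := by
      field_simp
      ring
    rw [hconv, hrw]
    refine key _ (fun α hα hα0 => ?_) (div_nonneg (by linarith) (by positivity))
    rw [div_lt_iff₀ (by positivity)] at hα
    refine ⟨by linarith, ?_⟩
    have : ρn * (σm * w) < (α * (1 - (1 - ρn) * w)) * (σm * w) := by
      have h1 : 0 ≤ (w - 1) * ((1 - σm) - (1 - ρn) * w) :=
        mul_nonneg (by linarith) (by linarith)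
      have h2 := mul_lt_mul_of_pos_right hα hden
      linarith
    have := lt_of_mul_lt_mul_right this (by positivity)
    linarith
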